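/- Let $n,r$ be positive integers. There are constants $d\in\mathbb N$ and $C\in\mathbb R$, depending only on $n$ and $r$, such that the following holds for every closed cube $Q\subset\mathbb R^n$ of positive side length with sides parallel to the axes, and all functions $f_1,\dots,f_r:Q\to\mathbb R$. *Objects attached to $f_1,\dots,f_r$.* For a family $(H_x)_{x\in Q}$ of linear subspaces of $\mathbb R^r$, its Glaeser refinement is the family with fiber $\{v\in H_x:\operatorname{dist}(v,H_y)\to0\text{ as }y\to x,\ y\in Q\}$ at $x$. Put $H^0_x=\{v\in\mathbb R^r:\sum_i v_if_i(x)=0\}$ and let $(H^{\ell}_x)_{x\in Q}$ be the $\ell$-th iterated Glaeser refinement of $(H^0_x)_{x\in Q}$. Let $\widetilde\xi_i(x)=0$ if $f_1(x)=\dots=f_r(x)=0$, and $\widetilde\xi_i(x)=f_i(x)/\sum_jf_j(x)^2$ otherwise. Call *admissible limit data* for $f_1,\dots,f_r$ a choice, for $1\le\ell\le 2r+1$, $\nu\ge1$, $1\le i,j\le r$, $x\in Q$, of vectors $\widetilde\lambda^{\ell}_i(x),\lambda^{\ell,\nu}_i(x),w_i(x)\in\mathbb R^r$, points $y^{\ell,\nu}_i(x)\in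 Q$ and coefficients $\beta^{\ell,\nu}_{ij}(x)\in\mathbb R$ such that, with $s=\dim (H^{\ell}_x)^\perp$ and with $\widetilde\lambda^0_i(x)$ the $i$-th standard basis vector: (a) $\widetilde\lambda^{\ell}_1(x),\dots,\widetilde\lambda^{\ell}_r(x)$ is a basis of $\mathbb R^r$, with $\widetilde\lambda^\ell_i(x)\in(H^{\ell}_x)^\perp$ for $i\le s$ and $\widetilde\lambda^\ell_i(x)\in H^{\ell}_x$ for $i>s$; (b) $y^{\ell,\nu}_i(x)\to x$ as $\nu\to\infty$ and $\lambda^{\ell,\nu}_i(x)\perp H^{\ell-1}_{y}$ at $y=y^{\ell,\nu}_i(x)$; if $i\le s$, then $\lambda^{\ell,\nu}_i(x)\to\widetilde\lambda^\ell_i(x)$ as $\nu\to\infty$; if $i>s$, then $y^{\ell,\nu}_i(x)=x$ and $\lambda^{\ell,\nu}_i(x)=0$ for all $\nu$; (c) $\lambda^{\ell,\nu}_i(x)=\sum_{j=1}^r\beta^{\ell,\nu}_{ij}(x)\,\widetilde\lambda^{\ell-1}_j\bigl(y^{\ell,\nu}_i(x)\bigr)$; (d) $v=\sum_{i=1}^r\bigl(\widetilde\lambda^{2r+1}_i(x)\cdot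 v\bigr)\,w_i(x)$ for all $v\in\mathbb R^r$. *Procedure.* Given admissible limit data, finite sets $S(x)\subset Q$ and linear maps $A(x,y):\mathbb R^r\to\mathbb R^r$, let $A_{ij}(x,y)$ be the $i$-th component of $A(x,y)w_j(y)$. For a function $\phi:Q\to\mathbb R$ compute, for all $x\in Q$ and $1\le i\le r$, $$\xi^0_i(x)=\widetilde\xi_i(x)\,\phi(x),\qquad \xi^\ell_i(x)=\lim_{\nu\to\infty}\sum_{j=1}^r\beta^{\ell,\nu}_{ij}(x)\,\xi^{\ell-1}_j\bigl(y^{\ell,\nu}_i(x)\bigr)\quad(1\le\ell\le2r+1),$$ $$\Phi_i(x)=\sum_{y\in S(x)}\sum_{j=1}^rA_{ij}(x,y)\,\xi^{2r+1}_j(y).$$ The procedure succeeds if all these limits exist. *Claim.* Admissible limit data for $f_1,\dots,f_r$ exist. Moreover, there are finite sets $S(x)\subset Q$ $(x\in Q)$ with at most $d$ points each, and linear maps $A(x,y):\mathbb R^r\to\mathbb R^r$, depending only on $f_1,\dots,f_r$, with the following property. For every choice of admissible limit data for $f_1,\dots,f_r$, every function $\phi:Q\to\mathbb R$, and all continuous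 $\phi_1,\dots,\phi_r:Q\to\mathbb R$ with $\phi_1f_1+\dots+\phi_rf_r=\phi$ on $Q$, the procedure succeeds, the resulting functions $\Phi_1,\dots,\Phi_r$ are continuous, $\Phi_1f_1+\dots+\Phi_rf_r=\phi$ on $Q$, and $$\max_{x\in Q,\,1\le i\le r}|\Phi_i(x)|\le C\max_{x\in Q,\,1\le i\le r}|\phi_i(x)|.$$ -/

import Mathlib

open Filter Topology

namespace GlaeserProcedure

/-- `ℝ^r` with its standard inner product. -/
abbrev Vec (r : ℕ) : Type := EuclideanSpace ℝ (Fin r)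

/-- The closed cube in `ℝ^n` with sides parallel to the axes, lowest corner `a`
and side length `δ`. -/
def closedCube {n : ℕ} (a : EuclideanSpace ℝ (Fin n)) (δ : ℝ) :
    Set (EuclideanSpace ℝ (Fin n)) :=
  {x | ∀ k, a k ≤ x k ∧ x k ≤ a k + δ}

section Bundles

variable {X : Type*} [TopologicalSpace X] {r : ℕ}

/-- The Glaeser refinement of a homogeneous bundle `(H_x)`: its fiber at `x` consists of the
`v ∈ H_x` with `dist (v, H_y) → 0` as `y → x`. -/
def glaeser (H : X → Submodule ℝ (Vec r)) (x : X) : Submodule ℝ (Vec r) where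
  carrier := {v | v ∈ H x ∧
    Tendsto (fun y => Metric.infDist v (H y : Set (Vec r))) (𝓝 x) (𝓝 0)}
  zero_mem' := by
    refine ⟨(H x).zero_mem, ?_⟩
    have h : (fun y => Metric.infDist (0 : Vec r) (H y : Set (Vec r))) = fun _ => 0 := by
      funext y
      exact Metric.infDist_zero_of_mem (H y).zero_mem
    rw [h]
    exact tendsto_const_nhds
  add_mem' := by
    rintro u v ⟨hu, hu'⟩ ⟨hv, hv'⟩
    refine ⟨(H x).add_mem hu hv, ?_⟩
    refine squeeze_zero (fun _ => Metric.infDist_nonneg) (fun y => ?_)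
      (by simpa using hu'.add hv')
    refine le_of_forall_pos_lt_add fun ε hε => ?_
    have hne : (H y : Set (Vec r)).Nonempty := ⟨0, (H y).zero_mem⟩
    obtain ⟨p, hp, hp'⟩ := (Metric.infDist_lt_iff hne).1
      (lt_add_of_pos_right (Metric.infDist u (H y : Set (Vec r))) (half_pos hε))
    obtain ⟨q, hq, hq'⟩ := (Metric.infDist_lt_iff hne).1
      (lt_add_of_pos_right (Metric.infDist v (H y : Set (Vec r))) (half_pos hε))
    have h1 := Metric.infDist_le_dist_of_mem (x := u + v) ((H y).add_mem hp hq)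
    have h2 := dist_add_add_le u v p q
    linarith
  smul_mem' := by
    rintro c v ⟨hv, hv'⟩
    refine ⟨(H x).smul_mem c hv, ?_⟩
    refine squeeze_zero (fun _ => Metric.infDist_nonneg) (fun y => ?_)
      (by simpa using hv'.const_mul (|c| + 1))
    have hne : (H y : Set (Vec r)).Nonempty := ⟨0, (H y).zero_mem⟩
    have hc : 0 < |c| + 1 := by positivity
    rw [← div_le_iff₀' hc]
    refine (Metric.le_infDist hne).2 fun p hp => ?_
    rw [div_le_iff₀' hc]
    have h1 := Metric.infDist_le_dist_of_mem (x := c • v) ((H y).smul_mem c hp)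
    have h2 : dist (c • v) (c • p) = |c| * dist v p := dist_smul₀ c v p
    have h3 : (0 : ℝ) ≤ dist v p := dist_nonneg
    linarith

/-- The `ℓ`-th iterated Glaeser refinement. -/
def glaeserIter (H : X → Submodule ℝ (Vec r)) (ℓ : ℕ) : X → Submodule ℝ (Vec r) :=
  glaeser^[ℓ] H

end Bundles

section Procedure

variable {X : Type*} {r : ℕ}

/-- The homogeneous bundle `H⁰_x = {v : v_1 f_1(x) + ⋯ + v_r f_r(x) = 0}`. -/
def kernelBundle (f : Fin r → X → ℝ) (x : X) : Submodule ℝ (Vec r) where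
  carrier := {v | ∑ i, v i * f i x = 0}
  zero_mem' := by simp
  add_mem' := by
    intro u v hu hv
    simp only [Set.mem_ofPred_eq] at hu hv ⊢
    simp [add_mul, Finset.sum_add_distrib, hu, hv]
  smul_mem' := by
    intro c v hv
    simp only [Set.mem_ofPred_eq] at hv ⊢
    simp [mul_assoc, ← Finset.mul_sum, hv]

/-- The objects from which the iterated limits are formed. The first argument of
`lam`, `lamSeq`, `y`, `β` is the level `ℓ`; the second one of `lamSeq`, `y`, `β` is the
sequence index `ν`. Only the values of `lam` with `ℓ ≤ 2r+1`, and those of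
`lamSeq`, `y`, `β` with `1 ≤ ℓ ≤ 2r+1`, are relevant. -/
structure LimitData (X : Type*) (r : ℕ) where
  lam : ℕ → X → Fin r → Vec r
  lamSeq : ℕ → ℕ → X → Fin r → Vec r
  y : ℕ → ℕ → X → Fin r → X
  β : ℕ → ℕ → X → Fin r → Fin r → ℝ
  w : X → Fin r → Vec r

open scoped InnerProductSpace in
/-- The objects in `D` arise from the homogeneous bundle `H` by the construction of the
iterated Glaeser refinements `H^ℓ`. Write `s = dim (H^{ℓ+1}_x)^⊥`. The vectors
`lam (ℓ+1) x i` form a basis of `ℝ^r`, the first `s` of them lying in `(H^{ℓ+1}_x)^⊥` and the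
remaining ones in `H^{ℓ+1}_x`; each of the first `s` is a limit of vectors orthogonal to the
fibers of `H^ℓ` at points tending to `x`. -/
structure LimitData.IsAdmissible [TopologicalSpace X] (D : LimitData X r)
    (H : X → Submodule ℝ (Vec r)) : Prop where
  lam_zero : ∀ x i, D.lam 0 x i = EuclideanSpace.single i 1
  lam_basis : ∀ ℓ < 2 * r + 1, ∀ x, LinearIndependent ℝ (D.lam (ℓ + 1) x)
  lam_mem_orthogonal : ∀ ℓ < 2 * r + 1, ∀ (x : X) (i : Fin r),
    (i : ℕ) < Module.finrank ℝ (glaeserIter H (ℓ + 1) x)ᗮ →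
      D.lam (ℓ + 1) x i ∈ (glaeserIter H (ℓ + 1) x)ᗮ
  lam_mem : ∀ ℓ < 2 * r + 1, ∀ (x : X) (i : Fin r),
    Module.finrank ℝ (glaeserIter H (ℓ + 1) x)ᗮ ≤ (i : ℕ) →
      D.lam (ℓ + 1) x i ∈ glaeserIter H (ℓ + 1) x
  y_tendsto : ∀ ℓ < 2 * r + 1, ∀ (x : X) (i : Fin r),
    Tendsto (fun ν => D.y (ℓ + 1) ν x i) atTop (𝓝 x)
  lamSeq_tendsto : ∀ ℓ < 2 * r + 1, ∀ (x : X) (i : Fin r),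
    (i : ℕ) < Module.finrank ℝ (glaeserIter H (ℓ + 1) x)ᗮ →
      Tendsto (fun ν => D.lamSeq (ℓ + 1) ν x i) atTop (𝓝 (D.lam (ℓ + 1) x i))
  lamSeq_orthogonal : ∀ ℓ < 2 * r + 1, ∀ (ν : ℕ) (x : X) (i : Fin r),
    D.lamSeq (ℓ + 1) ν x i ∈ (glaeserIter H ℓ (D.y (ℓ + 1) ν x i))ᗮ
  y_eq : ∀ ℓ < 2 * r + 1, ∀ (ν : ℕ) (x : X) (i : Fin r),
    Module.finrank ℝ (glaeserIter H (ℓ + 1) x)ᗮ ≤ (i : ℕ) → D.y (ℓ + 1) ν x i = x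
  lamSeq_eq : ∀ ℓ < 2 * r + 1, ∀ (ν : ℕ) (x : X) (i : Fin r),
    Module.finrank ℝ (glaeserIter H (ℓ + 1) x)ᗮ ≤ (i : ℕ) → D.lamSeq (ℓ + 1) ν x i = 0
  lamSeq_expand : ∀ ℓ < 2 * r + 1, ∀ (ν : ℕ) (x : X) (i : Fin r),
    D.lamSeq (ℓ + 1) ν x i =
      ∑ j, D.β (ℓ + 1) ν x i j • D.lam ℓ (D.y (ℓ + 1) ν x i) j
  w_dual : ∀ (x : X) (v : Vec r), v = ∑ i, ⟪D.lam (2 * r + 1) x i, v⟫_ℝ • D.w x i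

open Classical in
/-- `ξ̃_i(x)`: zero at the common zeros of the `f_j`, and `f_i / ∑ f_j²` elsewhere. -/
noncomputable def xiTilde (f : Fin r → X → ℝ) (x : X) (i : Fin r) : ℝ :=
  if ∀ j, f j x = 0 then 0 else f i x / ∑ j, f j x ^ 2

/-- The recursion for `ξ^ℓ_i(x)`. The value of `limUnder` is meaningful only if the limit
exists, which is what `Succeeds` requires. -/
noncomputable def xi (f : Fin r → X → ℝ) (D : LimitData X r) (φ : X → ℝ) :
    ℕ → X → Fin r → ℝ
  | 0 => fun x i => xiTilde f x i * φ x
  | ℓ + 1 => fun x i =>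
      limUnder atTop fun ν : ℕ =>
        ∑ j, D.β (ℓ + 1) ν x i j * xi f D φ ℓ (D.y (ℓ + 1) ν x i) j

/-- All limits in the recursion exist, up to level `2r+1`. -/
def Succeeds (f : Fin r → X → ℝ) (D : LimitData X r) (φ : X → ℝ) : Prop :=
  ∀ ℓ < 2 * r + 1, ∀ (x : X) (i : Fin r), ∃ L : ℝ,
    Tendsto (fun ν : ℕ =>
      ∑ j, D.β (ℓ + 1) ν x i j * xi f D φ ℓ (D.y (ℓ + 1) ν x i) j) atTop (𝓝 L)

/-- `A_{ij}(x,y)`: the `i`-th component of the vector `A(x,y) w_j(y)`. -/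
def coeff (D : LimitData X r) (A : X → X → Vec r →ₗ[ℝ] Vec r) (i j : Fin r) (x y : X) : ℝ :=
  A x y (D.w y j) i

/-- The output `Φ_i(x) = ∑_{y ∈ S(x)} ∑_j A_{ij}(x,y) ξ^{2r+1}_j(y)` of the procedure. -/
noncomputable def output (f : Fin r → X → ℝ) (D : LimitData X r) (S : X → Finset X)
    (A : X → X → Vec r →ₗ[ℝ] Vec r) (φ : X → ℝ) (i : Fin r) (x : X) : ℝ :=
  ∑ y ∈ S x, ∑ j, coeff D A i j x y * xi f D φ (2 * r + 1) y j

end Procedure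

end GlaeserProcedure

/-!
The vectors orthogonal to the fiber of `glaeser H` at `x` are spanned by limits of vectors
orthogonal to fibers of `H` at points tending to `x`. Hence, with `F x = (φ_1 x, …, φ_r x)`, level
`ℓ` of the recursion computes the component of `F x` orthogonal to the fiber of the `ℓ`-th
refinement. After `2r + 1` refinements the bundle `H` is stable, and the last level determines the
affine bundle `F x + H_x`. A section of it which is continuous on the closed set `{dim H_x < k}`
extends by Whitney's method to a continuous function on `X`, whose projection to the fibers is
continuous on `{dim H_x < k + 1}`. Each such step is linear and uses the values at boundedly many
points, and `r + 1` steps reach all of `X`.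
-/

namespace GlaeserProcedure

open scoped InnerProductSpace

section Projection

variable {𝕜 E : Type*} [RCLike 𝕜] [NormedAddCommGroup E] [InnerProductSpace 𝕜 E]

theorem infDist_eq_norm_starProjection_orthogonal (K : Submodule 𝕜 E) [K.HasOrthogonalProjection]
    (v : E) : Metric.infDist v (K : Set E) = ‖Kᗮ.starProjection v‖ := by
  rw [Submodule.starProjection_orthogonal_val, Submodule.starProjection_minimal,
    Metric.infDist_eq_iInf]
  simp only [dist_eq_norm]
  rfl

theorem inner_starProjection_of_mem {K : Submodule 𝕜 E} [K.HasOrthogonalProjection] {u : E}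
    (hu : u ∈ K) (v : E) : ⟪u, K.starProjection v⟫_𝕜 = ⟪u, v⟫_𝕜 :=
  Submodule.inner_orthogonalProjectionOnto_eq_of_mem_left ⟨u, hu⟩ v

theorem orthonormal_coe_stdOrthonormalBasis (W : Submodule 𝕜 E) [FiniteDimensional 𝕜 W] :
    Orthonormal 𝕜 fun j => (stdOrthonormalBasis 𝕜 W j : E) :=
  (stdOrthonormalBasis 𝕜 W).orthonormal.comp_linearIsometry W.subtypeₗᵢ

theorem sum_sq_norm_starProjection_le_finrank {ι : Type*} [Fintype ι] {e : ι → E}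
    (he : Orthonormal 𝕜 e) (K : Submodule 𝕜 E) [FiniteDimensional 𝕜 K] :
    ∑ j, ‖K.starProjection (e j)‖ ^ 2 ≤ Module.finrank 𝕜 K := by
  let b := stdOrthonormalBasis 𝕜 K
  have hproj (j : ι) : ‖K.starProjection (e j)‖ ^ 2 = ∑ i, ‖⟪e j, (b i : E)⟫_𝕜‖ ^ 2 := by
    rw [Submodule.starProjection_apply, ← Submodule.coe_norm, ← b.sum_sq_norm_inner_left]
    simp only [Submodule.inner_orthogonalProjectionOnto_eq_of_mem_right]
  calc ∑ j, ‖K.starProjection (e j)‖ ^ 2 = ∑ i, ∑ j, ‖⟪e j, (b i : E)⟫_𝕜‖ ^ 2 := by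
        exact (Finset.sum_congr rfl fun j _ => hproj j).trans Finset.sum_comm
    _ ≤ ∑ i, ‖(b i : E)‖ ^ 2 := Finset.sum_le_sum fun i _ => he.sum_inner_products_le _
    _ = Module.finrank 𝕜 K := by simp [b, (orthonormal_coe_stdOrthonormalBasis K).norm_eq_one]

theorem sq_norm_starProjection_le_of_orthonormal {m : ℕ} {e : Fin m → E} (he : Orthonormal 𝕜 e)
    (K : Submodule 𝕜 E) [FiniteDimensional 𝕜 K] {z : E} (hz : ∀ j, ⟪z, e j⟫_𝕜 = 0) :
    ‖K.starProjection z‖ ^ 2 ≤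
      ‖z‖ ^ 2 * (Module.finrank 𝕜 K - ∑ j, ‖K.starProjection (e j)‖ ^ 2) := by
  rcases eq_or_ne z 0 with rfl | hz0
  · simp
  have horth : Orthonormal 𝕜 (Matrix.vecCons ((‖z‖⁻¹ : 𝕜) • z) e) :=
    orthonormal_vecCons_iff.2 ⟨norm_smul_inv_norm hz0, fun j => by simp [inner_smul_left, hz], he⟩
  have hbessel := sum_sq_norm_starProjection_le_finrank horth K
  simp only [Fin.sum_univ_succ, Matrix.cons_val_zero, Matrix.cons_val_succ, map_smul, norm_smul,
    norm_inv, RCLike.norm_ofReal, abs_norm, mul_pow] at hbessel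
  rw [← le_sub_iff_add_le, inv_pow, inv_mul_le_iff₀ (by positivity)] at hbessel
  exact hbessel

variable {ι : Type*} {l : Filter ι} {K : ι → Submodule 𝕜 E} {W : Submodule 𝕜 E}

theorem tendsto_starProjection_apply [∀ i, (K i).HasOrthogonalProjection] {u : ι → E} {v w : E}
    (hu : Tendsto u l (𝓝 v)) (hv : Tendsto (fun i => (K i).starProjection v) l (𝓝 w)) :
    Tendsto (fun i => (K i).starProjection (u i)) l (𝓝 w) := by
  have hdiff : Tendsto (fun i => (K i).starProjection (u i - v)) l (𝓝 0) :=
    squeeze_zero_norm (fun i => (K i).norm_starProjection_apply_le _)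
      (tendsto_iff_norm_sub_tendsto_zero.1 hu)
  simpa using hdiff.add hv

variable [∀ i, FiniteDimensional 𝕜 (K i)] [FiniteDimensional 𝕜 W]

theorem tendsto_sum_sq_norm_starProjection
    (hW : ∀ v ∈ W, Tendsto (fun i => (K i).starProjection v) l (𝓝 v)) :
    Tendsto (fun i => ∑ j, ‖(K i).starProjection (stdOrthonormalBasis 𝕜 W j : E)‖ ^ 2) l
      (𝓝 (Module.finrank 𝕜 W)) := by
  have hlim := tendsto_finsetSum Finset.univ fun j _ =>
    (hW _ (stdOrthonormalBasis 𝕜 W j).2).norm.pow 2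
  simpa only [(orthonormal_coe_stdOrthonormalBasis W).norm_eq_one, one_pow, Finset.sum_const,
    Finset.card_univ, Fintype.card_fin, nsmul_eq_mul, mul_one] using hlim

theorem eventually_finrank_le_of_tendsto_starProjection
    (hW : ∀ v ∈ W, Tendsto (fun i => (K i).starProjection v) l (𝓝 v)) :
    ∀ᶠ i in l, Module.finrank 𝕜 W ≤ Module.finrank 𝕜 (K i) := by
  filter_upwards [(tendsto_sum_sq_norm_starProjection hW).eventually
    (lt_mem_nhds (sub_one_lt (Module.finrank 𝕜 W : ℝ)))] with i hi
  have hle := sum_sq_norm_starProjection_le_finrank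
    (orthonormal_coe_stdOrthonormalBasis W) (K i)
  exact Nat.lt_succ_iff.1 (by exact_mod_cast sub_lt_iff_lt_add.1 (hi.trans_le hle))

theorem tendsto_starProjection_of_mem_orthogonal
    (hW : ∀ v ∈ W, Tendsto (fun i => (K i).starProjection v) l (𝓝 v))
    (hdim : ∀ᶠ i in l, Module.finrank 𝕜 (K i) ≤ Module.finrank 𝕜 W) {z : E} (hz : z ∈ Wᗮ) :
    Tendsto (fun i => (K i).starProjection z) l (𝓝 0) := by
  let e := fun j => (stdOrthonormalBasis 𝕜 W j : E)
  have hlim : Tendsto (fun i => ‖z‖ ^ 2 *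
      (Module.finrank 𝕜 W - ∑ j, ‖(K i).starProjection (e j)‖ ^ 2)) l (𝓝 0) := by
    simpa using ((tendsto_sum_sq_norm_starProjection hW).const_sub
      (Module.finrank 𝕜 W : ℝ)).const_mul (‖z‖ ^ 2)
  have hsq : Tendsto (fun i => ‖(K i).starProjection z‖ ^ 2) l (𝓝 0) := by
    refine squeeze_zero' (.of_forall fun i => sq_nonneg _) ?_ hlim
    filter_upwards [hdim] with i hi
    refine (sq_norm_starProjection_le_of_orthonormal (orthonormal_coe_stdOrthonormalBasis W) (K i)
      fun j => Submodule.inner_left_of_mem_orthogonal (stdOrthonormalBasis 𝕜 W j).2 hz).trans ?_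
    gcongr
  rw [tendsto_zero_iff_norm_tendsto_zero]
  simpa using hsq.sqrt

theorem tendsto_starProjection_of_finrank_le
    (hW : ∀ v ∈ W, Tendsto (fun i => (K i).starProjection v) l (𝓝 v))
    (hdim : ∀ᶠ i in l, Module.finrank 𝕜 (K i) ≤ Module.finrank 𝕜 W) (v : E) :
    Tendsto (fun i => (K i).starProjection v) l (𝓝 (W.starProjection v)) := by
  have hadd := (hW _ (W.starProjection_apply_mem v)).add
    (tendsto_starProjection_of_mem_orthogonal hW hdim (Wᗮ.starProjection_apply_mem v))
  simpa only [← map_add, W.starProjection_add_starProjection_orthogonal, add_zero] using hadd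

end Projection

section Glaeser

variable {X : Type*} [TopologicalSpace X] {r : ℕ} {H H' : X → Submodule ℝ (Vec r)} {x : X}

theorem mem_glaeser_iff {v : Vec r} : v ∈ glaeser H x ↔
    v ∈ H x ∧ Tendsto (fun y => (H y)ᗮ.starProjection v) (𝓝 x) (𝓝 0) := by
  rw [tendsto_zero_iff_norm_tendsto_zero]
  simp only [← infDist_eq_norm_starProjection_orthogonal]
  rfl

theorem tendsto_starProjection_of_mem_glaeser {v : Vec r} (hv : v ∈ glaeser H x) :
    Tendsto (fun y => (H y).starProjection v) (𝓝 x) (𝓝 v) := by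
  simpa only [Submodule.starProjection_orthogonal_val, sub_sub_cancel, sub_zero] using
    (mem_glaeser_iff.1 hv).2.const_sub v

theorem glaeser_le (H : X → Submodule ℝ (Vec r)) (x : X) : glaeser H x ≤ H x := fun _ hv => hv.1

theorem eventually_finrank_glaeser_le (H : X → Submodule ℝ (Vec r)) (x : X) :
    ∀ᶠ y in 𝓝 x, Module.finrank ℝ (glaeser H x) ≤ Module.finrank ℝ (H y) :=
  eventually_finrank_le_of_tendsto_starProjection fun _ => tendsto_starProjection_of_mem_glaeser

theorem continuousWithinAt_starProjection_of_mem (hH : glaeser H = H) {s : Set X} {u : X → Vec r}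
    (hu : ContinuousWithinAt u s x) (hmem : u x ∈ H x) :
    ContinuousWithinAt (fun y => (H y).starProjection (u y)) s x := by
  have hlim := tendsto_starProjection_of_mem_glaeser (hH.symm ▸ hmem : u x ∈ glaeser H x)
  rw [ContinuousWithinAt, Submodule.starProjection_eq_self_iff.2 hmem]
  exact tendsto_starProjection_apply hu (hlim.mono_left nhdsWithin_le_nhds)

theorem continuousWithinAt_starProjection_of_finrank_le (hH : glaeser H = H) {s : Set X}
    (hs : ∀ y ∈ s, Module.finrank ℝ (H y) ≤ Module.finrank ℝ (H x)) {u : X → Vec r}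
    (hu : ContinuousWithinAt u s x) :
    ContinuousWithinAt (fun y => (H y).starProjection (u y)) s x := by
  refine tendsto_starProjection_apply hu (tendsto_starProjection_of_finrank_le (fun v hv => ?_)
    (eventually_mem_nhdsWithin.mono hs) (u x))
  exact (tendsto_starProjection_of_mem_glaeser (hH.symm ▸ hv)).mono_left nhdsWithin_le_nhds

theorem isClosed_setOf_finrank_lt (hH : glaeser H = H) (k : ℕ) :
    IsClosed {x | Module.finrank ℝ (H x) < k} := by
  rw [← isOpen_compl_iff, isOpen_iff_eventually]
  intro x hx
  filter_upwards [hH ▸ eventually_finrank_glaeser_le H x] with y hy hlt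
  exact hx (hy.trans_lt hlt)

theorem glaeser_eq_of_eventuallyEq (h : H =ᶠ[𝓝 x] H') : glaeser H x = glaeser H' x := by
  ext v
  rw [mem_glaeser_iff, mem_glaeser_iff, h.eq_of_nhds]
  exact and_congr_right fun _ => tendsto_congr' (h.mono fun y hy => by simp only [hy])

theorem glaeser_eventuallyEq (h : H =ᶠ[𝓝 x] H') : glaeser H =ᶠ[𝓝 x] glaeser H' :=
  (eventually_eventually_nhds.2 h).mono fun _ => glaeser_eq_of_eventuallyEq

theorem glaeserIter_succ (H : X → Submodule ℝ (Vec r)) (ℓ : ℕ) :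
    glaeserIter H (ℓ + 1) = glaeser (glaeserIter H ℓ) :=
  Function.iterate_succ_apply' _ _ _

theorem glaeserIter_antitone (H : X → Submodule ℝ (Vec r)) (x : X) :
    Antitone fun ℓ => glaeserIter H ℓ x :=
  antitone_nat_of_succ_le fun ℓ => by
    rw [glaeserIter_succ]
    exact glaeser_le _ _

theorem glaeserIter_eq_of_eventuallyEq_succ {m : ℕ}
    (h : glaeserIter H (m + 1) =ᶠ[𝓝 x] glaeserIter H m) {ℓ : ℕ} (hℓ : m ≤ ℓ) :
    glaeserIter H ℓ x = glaeserIter H m x := by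
  suffices hev : glaeserIter H ℓ =ᶠ[𝓝 x] glaeserIter H m from hev.eq_of_nhds
  induction hℓ with
  | refl => rfl
  | step _ ih =>
    rw [Nat.succ_eq_add_one, glaeserIter_succ]
    exact (glaeser_eventuallyEq ih).trans (by rwa [← glaeserIter_succ])

-- Near `x` the fibers of `H^{2k+1}` have dimension at least `r - k`; those of `H^{2k}` that are
-- larger have stabilized by induction, so `H^{2k}` and `H^{2k+1}` agree near `x`.
theorem glaeserIter_eq_of_lt_finrank (H : X → Submodule ℝ (Vec r)) {k : ℕ} {x : X}
    (hx : r < Module.finrank ℝ (glaeserIter H (2 * k) x) + k) {ℓ : ℕ} (hℓ : 2 * k ≤ ℓ) :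
    glaeserIter H ℓ x = glaeserIter H (2 * k) x := by
  induction k generalizing x ℓ with
  | zero =>
    have hle := (glaeserIter H 0 x).finrank_le.trans_eq finrank_euclideanSpace_fin
    exact absurd hx (not_lt.2 hle)
  | succ k ih =>
    have hstep : glaeserIter H (2 * k + 1) =ᶠ[𝓝 x] glaeserIter H (2 * k) := by
      filter_upwards [eventually_finrank_glaeser_le (glaeserIter H (2 * k + 1)) x] with y hy
      rw [← glaeserIter_succ] at hy
      by_cases hyk : r < Module.finrank ℝ (glaeserIter H (2 * k) y) + k
      · exact ih hyk (Nat.le_succ _)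
      · refine Submodule.eq_of_le_of_finrank_le (glaeserIter_antitone H y (Nat.le_succ _)) ?_
        exact Nat.le_of_add_le_add_right ((not_lt.1 hyk).trans
          ((Nat.lt_succ_iff.1 hx).trans (Nat.add_le_add_right hy k)))
    rw [glaeserIter_eq_of_eventuallyEq_succ hstep (ℓ := ℓ) (by lia),
      glaeserIter_eq_of_eventuallyEq_succ hstep (ℓ := 2 * (k + 1)) (by lia)]

theorem glaeserIter_eq_of_two_mul_le (H : X → Submodule ℝ (Vec r)) {ℓ : ℕ} (hℓ : 2 * r ≤ ℓ) :
    glaeserIter H ℓ = glaeserIter H (2 * r) := by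
  funext x
  rcases eq_or_ne (glaeserIter H (2 * r) x) ⊥ with hbot | hbot
  · exact (glaeserIter_antitone H x hℓ).antisymm (hbot.trans_le bot_le)
  · exact glaeserIter_eq_of_lt_finrank H
      (Nat.lt_add_of_pos_left (Submodule.one_le_finrank_iff.2 hbot)) hℓ

theorem glaeser_glaeserIter_eq (H : X → Submodule ℝ (Vec r)) {ℓ : ℕ} (hℓ : 2 * r ≤ ℓ) :
    glaeser (glaeserIter H ℓ) = glaeserIter H ℓ := by
  rw [← glaeserIter_succ, glaeserIter_eq_of_two_mul_le H hℓ,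
    glaeserIter_eq_of_two_mul_le H (Nat.le_succ_of_le hℓ)]

end Glaeser

section Depth

/-- The operator `L` has depth at most `d`: `L g` is linear in `g` and is computed from the values
of `g` at `d` points which do not depend on `g`. The finitely supported function `A` collects these
points together with the linear maps applied to the values at them. -/
def HasDepth (R : Type*) {X V W : Type*} [Semiring R] [AddCommMonoid V] [Module R V]
    [AddCommMonoid W] [Module R W] (d : ℕ) (L : (X → V) → W) : Prop :=
  ∃ A : X →₀ (V →ₗ[R] W), A.support.card ≤ d ∧ ∀ g, L g = A.sum fun y B => B (g y)

namespace HasDepth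

variable {R X V W Z : Type*} [Semiring R] [AddCommMonoid V] [Module R V] [AddCommMonoid W]
  [Module R W] [AddCommMonoid Z] [Module R Z] {d d' : ℕ} {L L' : (X → V) → W}

theorem mono (hL : HasDepth R d L) (h : d ≤ d') : HasDepth R d' L :=
  hL.imp fun _ hA => ⟨hA.1.trans h, hA.2⟩

theorem zero : HasDepth R d fun _ : X → V => (0 : W) :=
  ⟨0, by simp, fun _ => Finsupp.sum_zero_index.symm⟩

theorem eval (x : X) : HasDepth R 1 fun g : X → V => g x :=
  ⟨Finsupp.single x LinearMap.id, Finset.card_le_card Finsupp.support_single_subset, fun g => by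
    simp [Finsupp.sum_single_index]⟩

theorem map (hL : HasDepth R d L) (B : W →ₗ[R] Z) : HasDepth R d fun g => B (L g) := by
  obtain ⟨A, hA, hLA⟩ := hL
  refine ⟨A.mapRange B.comp B.comp_zero,
    (Finset.card_le_card Finsupp.support_mapRange).trans hA, fun g => ?_⟩
  simp [hLA, map_finsuppSum, Finsupp.sum_mapRange_index]

theorem add (hL : HasDepth R d L) (hL' : HasDepth R d' L') :
    HasDepth R (d + d') fun g => L g + L' g := by
  classical
  obtain ⟨A, hA, hLA⟩ := hL
  obtain ⟨A', hA', hLA'⟩ := hL'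
  refine ⟨A + A', (Finset.card_le_card Finsupp.support_add).trans
    ((Finset.card_union_le _ _).trans (add_le_add hA hA')), fun g => ?_⟩
  simp [hLA, hLA', Finsupp.sum_add_index']

theorem sum {ι : Type*} {s : Finset ι} {F : ι → (X → V) → W} (h : ∀ i ∈ s, HasDepth R d (F i)) :
    HasDepth R (s.card * d) fun g => ∑ i ∈ s, F i g := by
  induction s using Finset.cons_induction with
  | empty => exact zero
  | cons i s hi ih =>
    simp only [Finset.sum_cons, Finset.card_cons, add_comm s.card, add_mul, one_mul]
    exact (h i (Finset.mem_cons_self _ _)).add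
      (ih fun j hj => h j (Finset.mem_cons_of_mem hj))

theorem comp {P : (X → W) → Z} {T : (X → V) → X → W} (hP : HasDepth R d' P)
    (hT : ∀ x, HasDepth R d fun g => T g x) : HasDepth R (d' * d) fun g => P (T g) := by
  obtain ⟨A, hA, hPA⟩ := hP
  simp only [hPA]
  exact (sum fun y _ => (hT y).map (A y)).mono (Nat.mul_le_mul_right d hA)

end HasDepth

end Depth

section DyadicPartition

/-- The tent function, whose integer translates form a partition of unity on the line. -/
noncomputable def tent (t : ℝ) : ℝ := max 0 (1 - |t|)

/-- The two consecutive integers enclosing `t`: only the translates of `tent` by these can be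
nonzero at `t`. -/
noncomputable def floorPair (t : ℝ) : Finset ℤ := {⌊t⌋, ⌊t⌋ + 1}

theorem tent_nonneg (t : ℝ) : 0 ≤ tent t := le_max_left _ _

@[fun_prop]
theorem continuous_tent : Continuous tent := by
  unfold tent
  fun_prop

theorem tent_sub_eq_zero {t : ℝ} {k : ℤ} (hk : k ∉ floorPair t) : tent (t - k) = 0 := by
  simp only [floorPair, Finset.mem_insert, Finset.mem_singleton, not_or, ← ne_eq] at hk
  refine max_eq_left (sub_nonpos.2 ?_)
  rcases hk.1.lt_or_gt with hlt | hgt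
  · have hk1 : (k : ℝ) + 1 ≤ ⌊t⌋ := by exact_mod_cast hlt
    exact le_trans (by linarith [Int.floor_le t]) (le_abs_self _)
  · have hk1 : (⌊t⌋ : ℝ) + 1 + 1 ≤ k := by exact_mod_cast (Int.add_one_le_of_lt hgt).lt_of_ne' hk.2
    exact le_trans (by linarith [Int.lt_floor_add_one t]) (neg_le_abs _)

theorem sum_tent_sub (t : ℝ) : ∑ k ∈ floorPair t, tent (t - k) = 1 := by
  have hfract := Int.fract_nonneg t
  have hfract' := (Int.fract_lt_one t).le
  rw [floorPair, Finset.sum_pair (by lia), Int.cast_add, Int.cast_one, ← sub_sub,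
    Int.self_sub_floor, tent, tent, abs_of_nonneg hfract, abs_of_nonpos (by linarith),
    max_eq_right (by linarith), max_eq_right (by linarith)]
  ring

theorem abs_sub_le_one_of_mem_floorPair {t : ℝ} {k : ℤ} (hk : k ∈ floorPair t) : |t - k| ≤ 1 := by
  have hle := Int.floor_le t
  have hlt := Int.lt_floor_add_one t
  simp only [floorPair, Finset.mem_insert, Finset.mem_singleton] at hk
  rcases hk with rfl | rfl <;> push_cast <;> rw [abs_le] <;> constructor <;> linarith

theorem card_floorPair_le (t : ℝ) : (floorPair t).card ≤ 2 := Finset.card_le_two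

theorem exists_eventually_floorPair_subset {Y : Type*} [TopologicalSpace Y] {u : Y → ℝ} {y₀ : Y}
    (hu : ContinuousAt u y₀) : ∃ J : Finset ℤ, ∀ᶠ y in 𝓝 y₀, floorPair (u y) ⊆ J := by
  refine ⟨Finset.Icc (⌊u y₀⌋ - 1) (⌊u y₀⌋ + 2), ?_⟩
  filter_upwards [hu.eventually (Metric.ball_mem_nhds _ one_pos)] with y hy k hk
  rw [Real.dist_eq, abs_lt] at hy
  have hge : ⌊u y₀⌋ - 1 ≤ ⌊u y⌋ := by
    rw [Int.le_floor]
    push_cast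
    linarith [Int.floor_le (u y₀)]
  have hlt : ⌊u y⌋ < ⌊u y₀⌋ + 2 := by
    rw [Int.floor_lt]
    push_cast
    linarith [Int.lt_floor_add_one (u y₀)]
  simp only [floorPair, Finset.mem_insert, Finset.mem_singleton] at hk
  rw [Finset.mem_Icc]
  lia

variable {n : ℕ}

/-- The lattice point `2^k m` of `ℝ^n` of scale `i = (k, m)`. -/
noncomputable def dyadicPoint (i : Σ _ : ℤ, Fin n → ℤ) : EuclideanSpace ℝ (Fin n) :=
  WithLp.toLp 2 fun j => 2 ^ i.1 * i.2 j

/-- The indices of the members of the partition of unity `dyadicBump` which can be nonzero at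
`(t, x)`. -/
noncomputable def dyadicIdx (t : ℝ) (x : EuclideanSpace ℝ (Fin n)) :
    Finset (Σ _ : ℤ, Fin n → ℤ) :=
  (floorPair t).sigma fun k => Fintype.piFinset fun j => floorPair (x j / 2 ^ k)

/-- A partition of unity on `ℝ × ℝ^n`; the member with index `(k, m)` lives on a neighborhood of
size `2^k` of the lattice point `2^k m` at the parameters `t` with `|t - k| ≤ 1`. -/
noncomputable def dyadicBump (i : Σ _ : ℤ, Fin n → ℤ) (t : ℝ) (x : EuclideanSpace ℝ (Fin n)) : ℝ :=
  tent (t - i.1) * ∏ j, tent (x j / 2 ^ i.1 - i.2 j)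

theorem dyadicBump_nonneg (i : Σ _ : ℤ, Fin n → ℤ) (t : ℝ) (x : EuclideanSpace ℝ (Fin n)) :
    0 ≤ dyadicBump i t x :=
  mul_nonneg (tent_nonneg _) (Finset.prod_nonneg fun _ _ => tent_nonneg _)

theorem continuous_dyadicBump (i : Σ _ : ℤ, Fin n → ℤ) :
    Continuous fun p : ℝ × EuclideanSpace ℝ (Fin n) => dyadicBump i p.1 p.2 := by
  unfold dyadicBump
  fun_prop

theorem card_dyadicIdx_le (t : ℝ) (x : EuclideanSpace ℝ (Fin n)) :
    (dyadicIdx t x).card ≤ 2 * 2 ^ n := by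
  have hfiber (k : ℤ) :
      (Fintype.piFinset fun j => floorPair (x j / 2 ^ k)).card ≤ 2 ^ n := by
    simpa using Finset.prod_le_pow_card Finset.univ (fun j => (floorPair (x j / 2 ^ k)).card) 2
      fun j _ => card_floorPair_le _
  rw [dyadicIdx, Finset.card_sigma]
  exact (Finset.sum_le_card_nsmul _ _ _ fun k _ => hfiber k).trans
    (Nat.mul_le_mul_right _ (card_floorPair_le t))

theorem sum_dyadicBump (t : ℝ) (x : EuclideanSpace ℝ (Fin n)) :
    ∑ i ∈ dyadicIdx t x, dyadicBump i t x = 1 := by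
  simp only [dyadicIdx, dyadicBump, Finset.sum_sigma, ← Finset.mul_sum]
  refine (Finset.sum_congr rfl fun k _ => ?_).trans (sum_tent_sub t)
  rw [← Finset.prod_univ_sum (fun j => floorPair (x j / 2 ^ k)) fun j m => tent (x j / 2 ^ k - m)]
  simp only [sum_tent_sub, Finset.prod_const_one, mul_one]

theorem dyadicBump_eq_zero {t : ℝ} {x : EuclideanSpace ℝ (Fin n)} {i : Σ _ : ℤ, Fin n → ℤ}
    (hi : i ∉ dyadicIdx t x) : dyadicBump i t x = 0 := by
  simp only [dyadicIdx, Finset.mem_sigma, Fintype.mem_piFinset, not_and_or, not_forall] at hi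
  rcases hi with hk | ⟨j, hj⟩
  · rw [dyadicBump, tent_sub_eq_zero hk, zero_mul]
  · rw [dyadicBump, Finset.prod_eq_zero (Finset.mem_univ j) (tent_sub_eq_zero hj), mul_zero]

theorem fst_le_add_one_of_mem_dyadicIdx {t : ℝ} {x : EuclideanSpace ℝ (Fin n)}
    {i : Σ _ : ℤ, Fin n → ℤ} (hi : i ∈ dyadicIdx t x) : (i.1 : ℝ) ≤ t + 1 := by
  linarith [neg_le_of_abs_le (abs_sub_le_one_of_mem_floorPair (Finset.mem_sigma.1 hi).1)]

theorem norm_le_sqrt_mul_of_forall_abs_le {v : EuclideanSpace ℝ (Fin n)} {c : ℝ} (hc : 0 ≤ c)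
    (h : ∀ j, |v j| ≤ c) : ‖v‖ ≤ √n * c := by
  have hsum : ∑ j, ‖v j‖ ^ 2 ≤ n * c ^ 2 := by
    simpa using Finset.sum_le_card_nsmul Finset.univ (fun j => ‖v j‖ ^ 2) (c ^ 2)
      fun j _ => pow_le_pow_left₀ (norm_nonneg _) (h j) 2
  rw [EuclideanSpace.norm_eq]
  exact (Real.sqrt_le_sqrt hsum).trans_eq (by rw [Real.sqrt_mul' _ (sq_nonneg c), Real.sqrt_sq hc])

theorem dist_dyadicPoint_le {t : ℝ} {x : EuclideanSpace ℝ (Fin n)} {i : Σ _ : ℤ, Fin n → ℤ}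
    (hi : i ∈ dyadicIdx t x) : dist x (dyadicPoint i) ≤ √n * 2 ^ i.1 := by
  have hscale : (0 : ℝ) < 2 ^ i.1 := zpow_pos two_pos _
  rw [dist_eq_norm]
  refine norm_le_sqrt_mul_of_forall_abs_le hscale.le fun j => ?_
  have hcoord : (x - dyadicPoint i) j = 2 ^ i.1 * (x j / 2 ^ i.1 - i.2 j) := by
    simp only [dyadicPoint, PiLp.sub_apply]
    field_simp
  rw [hcoord, abs_mul, abs_of_pos hscale]
  exact mul_le_of_le_one_right hscale.le (abs_sub_le_one_of_mem_floorPair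
    (Fintype.mem_piFinset.1 (Finset.mem_sigma.1 hi).2 j))

theorem exists_eventually_dyadicIdx_subset (t₀ : ℝ) (x₀ : EuclideanSpace ℝ (Fin n)) :
    ∃ J : Finset (Σ _ : ℤ, Fin n → ℤ), ∀ᶠ p in 𝓝 (t₀, x₀), dyadicIdx p.1 p.2 ⊆ J := by
  obtain ⟨J₀, hJ₀⟩ := exists_eventually_floorPair_subset
    (continuous_fst.continuousAt (x := (t₀, x₀)))
  have hcoord (k : ℤ) (j : Fin n) : ∃ J : Finset ℤ, ∀ᶠ p in 𝓝 (t₀, x₀),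
      floorPair (p.2 j / 2 ^ k) ⊆ J :=
    exists_eventually_floorPair_subset (by fun_prop)
  choose J hJ using hcoord
  refine ⟨J₀.sigma fun k => Fintype.piFinset (J k), ?_⟩
  filter_upwards [hJ₀, (Filter.eventually_all_finset J₀).2 fun k _ => eventually_all.2 (hJ k)]
    with p hp₀ hp
  intro i hi
  obtain ⟨hk, hm⟩ := Finset.mem_sigma.1 hi
  exact Finset.mem_sigma.2 ⟨hp₀ hk, Fintype.mem_piFinset.2 fun j =>
    hp i.1 (hp₀ hk) j (Fintype.mem_piFinset.1 hm j)⟩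

end DyadicPartition

section Extension

/-- A partition of unity `bump` off the set `E`, at most `N` members of which are nonzero at any
given point, together with points of `E` attached to its members whose distance to the places where
the member is nonzero is controlled by the distance of these to `E`. The finite set `idx x` contains
the indices of the members which are nonzero at `x`. -/
structure WhitneyPartition {X : Type*} [PseudoMetricSpace X] (E : Set X) (N : ℕ) (K : ℝ) where
  ι : Type
  idx : X → Finset ι
  bump : ι → X → ℝ
  pt : ι → X
  pt_mem : ∀ i, pt i ∈ E
  bump_nonneg : ∀ i x, 0 ≤ bump i x
  bump_eq_zero : ∀ x, ∀ i ∉ idx x, bump i x = 0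
  sum_bump : ∀ x, ∑ i ∈ idx x, bump i x = 1
  continuousAt_bump : ∀ i, ∀ x ∉ E, ContinuousAt (bump i) x
  card_idx_le : ∀ x, (idx x).card ≤ N
  exists_eventually_idx_subset : ∀ x₀ ∉ E, ∃ J : Finset ι, ∀ᶠ x in 𝓝 x₀, idx x ⊆ J
  dist_pt_le : ∀ x ∉ E, ∀ i ∈ idx x, dist (pt i) x ≤ K * Metric.infDist x E

theorem two_zpow_le_of_mem_dyadicIdx {n : ℕ} {δ : ℝ} (hδ : 0 < δ) {x : EuclideanSpace ℝ (Fin n)}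
    {i : Σ _ : ℤ, Fin n → ℤ} (hi : i ∈ dyadicIdx (Real.logb 2 δ) x) : (2 : ℝ) ^ i.1 ≤ 2 * δ :=
  calc (2 : ℝ) ^ i.1 = 2 ^ (i.1 : ℝ) := (Real.rpow_intCast _ _).symm
    _ ≤ 2 ^ (Real.logb 2 δ + 1) :=
      Real.rpow_le_rpow_of_exponent_le one_le_two (fst_le_add_one_of_mem_dyadicIdx hi)
    _ = 2 * δ := by
      rw [Real.rpow_add two_pos, Real.rpow_logb two_pos (by norm_num) hδ, Real.rpow_one, mul_comm]

-- The partition of unity on `ℝ × ℝ^n` is evaluated at `(log₂ (dist x E), x)`, so that the members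
-- which are nonzero at `x` have scale comparable to `dist x E`.
theorem nonempty_whitneyPartition {n : ℕ} {X : Set (EuclideanSpace ℝ (Fin n))} {E : Set X}
    (hE : IsClosed E) (hne : E.Nonempty) :
    Nonempty (WhitneyPartition E (2 * 2 ^ n) (4 * √n + 3)) := by
  have hpos (x : X) (hx : x ∉ E) : 0 < Metric.infDist x E := (hE.notMem_iff_infDist_pos hne).1 hx
  have hnear (i : Σ _ : ℤ, Fin n → ℤ) : ∃ p ∈ E, dist (dyadicPoint i) p <
      Metric.infDist (dyadicPoint i) (Subtype.val '' E) + 2 ^ i.1 := by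
    simpa using (Metric.infDist_lt_iff (hne.image _)).1
      (lt_add_of_pos_right (Metric.infDist (dyadicPoint i) (Subtype.val '' E))
        (zpow_pos (zero_lt_two' ℝ) i.1))
  choose pt hpt hdist using hnear
  let t (x : X) : ℝ := Real.logb 2 (Metric.infDist x E)
  have hcont (x : X) (hx : x ∉ E) : ContinuousAt (fun x : X => (t x, x.1)) x :=
    ((Metric.continuous_infDist_pt E).continuousAt.logb (hpos x hx).ne').prodMk
      continuous_subtype_val.continuousAt
  exact ⟨{
    ι := Σ _ : ℤ, Fin n → ℤ
    idx := fun x => dyadicIdx (t x) x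
    bump := fun i x => dyadicBump i (t x) x
    pt := pt
    pt_mem := hpt
    bump_nonneg := fun i x => dyadicBump_nonneg i _ _
    bump_eq_zero := fun x i hi => dyadicBump_eq_zero hi
    sum_bump := fun x => sum_dyadicBump _ _
    continuousAt_bump := fun i x hx => (continuous_dyadicBump i).continuousAt.comp (hcont x hx)
    card_idx_le := fun x => card_dyadicIdx_le _ _
    exists_eventually_idx_subset := fun x hx =>
      (exists_eventually_dyadicIdx_subset (t x) x.1).imp fun _ hJ => (hcont x hx).eventually hJ
    dist_pt_le := fun x hx i hi => by
      have hscale := two_zpow_le_of_mem_dyadicIdx (hpos x hx) hi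
      have hpoint := dist_dyadicPoint_le hi
      have htri := dist_triangle_right (pt i : EuclideanSpace ℝ (Fin n)) x (dyadicPoint i)
      have hinf := Metric.infDist_le_infDist_add_dist (s := Subtype.val '' E)
        (x := dyadicPoint i) (y := (x : EuclideanSpace ℝ (Fin n)))
      rw [Metric.infDist_image isometry_subtype_coe, dist_comm (dyadicPoint i)] at hinf
      have hdist := hdist i
      rw [dist_comm] at hdist
      rw [Subtype.dist_eq]
      nlinarith [mul_le_mul_of_nonneg_left hscale (show 0 ≤ 2 * √n + 1 by positivity)] }⟩

namespace WhitneyPartition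

variable {X V : Type*} [PseudoMetricSpace X] [NormedAddCommGroup V] [NormedSpace ℝ V]
  {E : Set X} {N : ℕ} {K : ℝ} (𝒲 : WhitneyPartition E N K) {u : X → V} {x : X}

open Classical in
/-- Whitney's extension of a function from `E`: off `E`, the average of its values at the points
attached to the members of the partition of unity. -/
noncomputable def extend (u : X → V) (x : X) : V :=
  if x ∈ E then u x else ∑ i ∈ 𝒲.idx x, 𝒲.bump i x • u (𝒲.pt i)

theorem extend_of_mem (hx : x ∈ E) : 𝒲.extend u x = u x := if_pos hx

theorem extend_of_notMem (hx : x ∉ E) :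
    𝒲.extend u x = ∑ i ∈ 𝒲.idx x, 𝒲.bump i x • u (𝒲.pt i) := if_neg hx

theorem extend_mem_of_convex {C : Set V} (hC : Convex ℝ C) (hx : x ∉ E)
    (h : ∀ i ∈ 𝒲.idx x, u (𝒲.pt i) ∈ C) : 𝒲.extend u x ∈ C := by
  rw [𝒲.extend_of_notMem hx]
  exact hC.sum_mem (fun i _ => 𝒲.bump_nonneg i x) (𝒲.sum_bump x) h

theorem norm_extend_le {M : ℝ} (h : ∀ p ∈ E, ‖u p‖ ≤ M) (x : X) : ‖𝒲.extend u x‖ ≤ M := by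
  by_cases hx : x ∈ E
  · rw [𝒲.extend_of_mem hx]
    exact h x hx
  · rw [← mem_closedBall_zero_iff]
    exact 𝒲.extend_mem_of_convex (convex_closedBall 0 M) hx fun i _ =>
      mem_closedBall_zero_iff.2 (h _ (𝒲.pt_mem i))

theorem hasDepth_extend (hN : N ≠ 0) (x : X) : HasDepth ℝ N fun u : X → V => 𝒲.extend u x := by
  by_cases hx : x ∈ E
  · simp only [𝒲.extend_of_mem hx]
    exact (HasDepth.eval x).mono (Nat.one_le_iff_ne_zero.2 hN)
  · simp only [𝒲.extend_of_notMem hx]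
    exact (HasDepth.sum fun i _ => (HasDepth.eval (𝒲.pt i)).map
      (LinearMap.lsmul ℝ V (𝒲.bump i x))).mono ((mul_one _).trans_le (𝒲.card_idx_le x))

theorem continuousAt_extend_of_notMem (hE : IsClosed E) (hx : x ∉ E) :
    ContinuousAt (𝒲.extend u) x := by
  obtain ⟨J, hJ⟩ := 𝒲.exists_eventually_idx_subset x hx
  have hsum : ContinuousAt (fun x => ∑ i ∈ J, 𝒲.bump i x • u (𝒲.pt i)) x :=
    tendsto_finsetSum J fun i _ => (𝒲.continuousAt_bump i x hx).smul continuousAt_const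
  refine hsum.congr ?_
  filter_upwards [hJ, hE.isOpen_compl.mem_nhds hx] with y hy hyE
  rw [𝒲.extend_of_notMem hyE]
  exact (Finset.sum_subset hy fun i _ hi => by rw [𝒲.bump_eq_zero y i hi, zero_smul]).symm

theorem continuousAt_extend_of_mem (hK : 0 ≤ K) (hx : x ∈ E) (hu : ContinuousWithinAt u E x) :
    ContinuousAt (𝒲.extend u) x := by
  refine Metric.nhds_basis_closedBall.tendsto_right_iff.2 fun ε hε => ?_
  obtain ⟨η, hη, hηu⟩ := Metric.mem_nhdsWithin_iff.1 (hu (Metric.closedBall_mem_nhds _ hε))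
  rw [𝒲.extend_of_mem hx]
  filter_upwards [Metric.ball_mem_nhds x (show 0 < η / (K + 1) by positivity)] with y hy
  rw [Metric.mem_ball, lt_div_iff₀ (by positivity)] at hy
  by_cases hyE : y ∈ E
  · rw [𝒲.extend_of_mem hyE]
    exact hηu ⟨(le_mul_of_one_le_right dist_nonneg (le_add_of_nonneg_left hK)).trans_lt hy, hyE⟩
  · refine 𝒲.extend_mem_of_convex (convex_closedBall _ _) hyE fun i hi =>
      hηu ⟨?_, 𝒲.pt_mem i⟩
    calc dist (𝒲.pt i) x ≤ dist (𝒲.pt i) y + dist y x := dist_triangle _ _ _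
      _ ≤ K * dist y x + dist y x := by
        gcongr
        exact (𝒲.dist_pt_le y hyE i hi).trans
          (mul_le_mul_of_nonneg_left (Metric.infDist_le_dist_of_mem hx) hK)
      _ = dist y x * (K + 1) := by ring
      _ < η := hy

end WhitneyPartition

/-- `P` extends functions on `E`, linearly and with depth at most `N`, to all of `X`; it preserves
continuity and bounds. A function on `E` is represented by any function on `X` restricting
to it. -/
structure IsExtensionOperator {X V : Type*} [TopologicalSpace X] [NormedAddCommGroup V]
    [NormedSpace ℝ V] (E : Set X) (N : ℕ) (P : (X → V) → X → V) : Prop where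
  hasDepth : ∀ x, HasDepth ℝ N fun u => P u x
  continuous : ∀ u, ContinuousOn u E → Continuous (P u)
  eqOn : ∀ u, Set.EqOn (P u) u E
  norm_le : ∀ u, ∀ M ≥ 0, (∀ x ∈ E, ‖u x‖ ≤ M) → ∀ x, ‖P u x‖ ≤ M

theorem exists_isExtensionOperator {n : ℕ} {X : Set (EuclideanSpace ℝ (Fin n))} {V : Type*}
    [NormedAddCommGroup V] [NormedSpace ℝ V] {E : Set X} (hE : IsClosed E) :
    ∃ P : (X → V) → X → V, IsExtensionOperator E (2 * 2 ^ n) P := by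
  rcases E.eq_empty_or_nonempty with rfl | hne
  · exact ⟨fun _ _ => 0, fun _ => .zero, fun _ _ => continuous_const, fun _ => Set.eqOn_empty _ _,
      fun _ _ hM _ _ => norm_zero.trans_le hM⟩
  obtain ⟨𝒲⟩ := nonempty_whitneyPartition hE hne
  refine ⟨𝒲.extend, 𝒲.hasDepth_extend (by positivity), fun u hu => ?_,
    fun u x hx => 𝒲.extend_of_mem hx, fun u M _ h => 𝒲.norm_extend_le h⟩
  refine continuous_iff_continuousAt.2 fun x => ?_
  by_cases hx : x ∈ E
  · exact 𝒲.continuousAt_extend_of_mem (by positivity) hx (hu x hx)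
  · exact 𝒲.continuousAt_extend_of_notMem hE hx

end Extension

section Selection

variable {X : Type*} {r N : ℕ} (H : X → Submodule ℝ (Vec r))
  (P : ℕ → (X → Vec r) → X → Vec r)

/-- The selection from the affine bundle `g x + H x` over the set of the `x` with `dim (H x) < k`,
built by recursion on `k`: the selection over the previous set, extended by `P k` to all of `X`, is
projected to the fibers. -/
noncomputable def selection : ℕ → (X → Vec r) → X → Vec r
  | 0 => fun _ _ => 0
  | k + 1 => fun g x => g x + (H x).starProjection (P k (selection k g) x)

variable {H P}

theorem selection_succ_orthogonal (k : ℕ) (F : X → Vec r) (x : X) :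
    selection H P (k + 1) (fun y => (H y)ᗮ.starProjection (F y)) x = F x +
      (H x).starProjection
        (P k (selection H P k fun y => (H y)ᗮ.starProjection (F y)) x - F x) := by
  simp only [selection, map_sub, Submodule.starProjection_orthogonal_val]
  abel

theorem selection_sub_mem (k : ℕ) (F : X → Vec r) (x : X) :
    selection H P (k + 1) (fun y => (H y)ᗮ.starProjection (F y)) x - F x ∈ H x := by
  rw [selection_succ_orthogonal, add_sub_cancel_left]
  exact Submodule.starProjection_apply_mem _ _

variable [TopologicalSpace X]
  (hP : ∀ k, IsExtensionOperator {x | Module.finrank ℝ (H x) < k} N (P k))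

include hP

theorem hasDepth_selection (k : ℕ) (x : X) :
    HasDepth ℝ (∑ i ∈ Finset.range k, N ^ i) fun g => selection H P k g x := by
  induction k generalizing x with
  | zero => exact .zero
  | succ k ih =>
    rw [geom_sum_succ, add_comm]
    exact (HasDepth.eval x).add
      ((((hP k).hasDepth x).comp ih).map (H x).starProjection.toLinearMap)

theorem norm_selection_le {g : X → Vec r} {M : ℝ} (hg : ∀ x, ‖g x‖ ≤ M) (k : ℕ) (x : X) :
    ‖selection H P k g x‖ ≤ k * M := by
  have hM : 0 ≤ M := (norm_nonneg _).trans (hg x)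
  induction k generalizing x with
  | zero => simp [selection]
  | succ k ih =>
    calc ‖g x + (H x).starProjection (P k (selection H P k g) x)‖
        ≤ ‖g x‖ + ‖P k (selection H P k g) x‖ :=
          (norm_add_le _ _).trans (by gcongr; exact Submodule.norm_starProjection_apply_le _ _)
      _ ≤ M + k * M :=
          add_le_add (hg x) ((hP k).norm_le _ _ (by positivity) (fun y _ => ih y) x)
      _ = (k + 1 : ℕ) * M := by push_cast; ring

theorem continuousOn_selection (hH : glaeser H = H) {F : X → Vec r} (hF : Continuous F) (k : ℕ) :
    ContinuousOn (selection H P k fun x => (H x)ᗮ.starProjection (F x))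
      {x | Module.finrank ℝ (H x) < k} := by
  induction k with
  | zero => simp
  | succ k ih =>
    have hψ := ((hP k).continuous _ ih).sub hF
    refine (hF.continuousOn.add fun x hx => ?_).congr
      fun x _ => selection_succ_orthogonal k F x
    by_cases hxk : Module.finrank ℝ (H x) < k
    · refine continuousWithinAt_starProjection_of_mem hH hψ.continuousWithinAt ?_
      obtain ⟨k, rfl⟩ := Nat.exists_eq_add_one_of_ne_zero hxk.ne_bot
      rw [(hP _).eqOn _ hxk]
      exact selection_sub_mem k F x
    · exact continuousWithinAt_starProjection_of_finrank_le hH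
        (fun y hy => (Nat.lt_succ_iff.1 hy).trans (not_lt.1 hxk)) hψ.continuousWithinAt

end Selection

section Recursion

theorem orthogonal_kernelBundle {X : Type*} {r : ℕ} (f : Fin r → X → ℝ) (x : X) :
    (kernelBundle f x)ᗮ = ℝ ∙ (WithLp.toLp 2 fun i => f i x : Vec r) := by
  rw [← Submodule.orthogonal_orthogonal (ℝ ∙ _)]
  congr 1
  ext v
  rw [Submodule.mem_orthogonal_singleton_iff_inner_right, PiLp.inner_apply]
  rfl

theorem xiTilde_eq {X : Type*} {r : ℕ} (f : Fin r → X → ℝ) (x : X) (i : Fin r) :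
    xiTilde f x i = f i x / ∑ j, f j x ^ 2 := by
  unfold xiTilde
  split_ifs with h
  · rw [h i, zero_div]
  · rfl

variable {X : Type*} {r : ℕ}

theorem sum_mul_eq_of_sub_mem_kernelBundle {f : Fin r → X → ℝ} {x : X} {u v : Vec r}
    (h : u - v ∈ kernelBundle f x) : ∑ i, u i * f i x = ∑ i, v i * f i x := by
  have hsum : ∑ i, (u - v) i * f i x = 0 := h
  simpa only [PiLp.sub_apply, sub_mul, Finset.sum_sub_distrib, sub_eq_zero] using hsum

theorem output_eq (f : Fin r → X → ℝ) (D : LimitData X r) (S : X → Finset X)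
    (A : X → X → Vec r →ₗ[ℝ] Vec r) (φ : X → ℝ) (i : Fin r) (x : X) :
    output f D S A φ i x =
      (∑ y ∈ S x, A x y (∑ j, xi f D φ (2 * r + 1) y j • D.w y j)) i := by
  simp [output, coeff, map_sum, mul_comm]

variable {f : Fin r → X → ℝ} {D : LimitData X r} {φ : X → ℝ} {F : X → Vec r}
  [TopologicalSpace X]

theorem xi_zero_eq_inner {H : X → Submodule ℝ (Vec r)} (hD : D.IsAdmissible H)
    (hφ : ∀ x, ∑ i, F x i * f i x = φ x) (x : X) (i : Fin r) :
    xi f D φ 0 x i = ⟪D.lam 0 x i, (kernelBundle f x)ᗮ.starProjection (F x)⟫_ℝ := by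
  simp only [orthogonal_kernelBundle, Submodule.starProjection_singleton, hD.lam_zero, xi,
    xiTilde_eq, ← hφ, EuclideanSpace.inner_single_left]
  simp only [PiLp.smul_apply, PiLp.inner_apply, RCLike.inner_apply, conj_trivial,
    EuclideanSpace.real_norm_sq_eq, RCLike.ofReal_real_eq_id, id, smul_eq_mul, one_mul]
  ring

-- Only the component of `F x` orthogonal to the fiber survives: the `lamSeq` are orthogonal to the
-- fibers of level `ℓ`, and their limits are orthogonal to the fiber of level `ℓ + 1`.
theorem tendsto_sum_mul_xi {H : X → Submodule ℝ (Vec r)} (hD : D.IsAdmissible H)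
    (hF : Continuous F) {ℓ : ℕ} (hℓ : ℓ < 2 * r + 1)
    (hxi : ∀ x i, xi f D φ ℓ x i =
      ⟪D.lam ℓ x i, (glaeserIter H ℓ x)ᗮ.starProjection (F x)⟫_ℝ) (x : X) (i : Fin r) :
    Tendsto (fun ν => ∑ j, D.β (ℓ + 1) ν x i j * xi f D φ ℓ (D.y (ℓ + 1) ν x i) j) atTop
      (𝓝 ⟪D.lam (ℓ + 1) x i, (glaeserIter H (ℓ + 1) x)ᗮ.starProjection (F x)⟫_ℝ) := by
  have hsum (ν : ℕ) : ∑ j, D.β (ℓ + 1) ν x i j * xi f D φ ℓ (D.y (ℓ + 1) ν x i) j =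
      ⟪D.lamSeq (ℓ + 1) ν x i, F (D.y (ℓ + 1) ν x i)⟫_ℝ := by
    rw [← inner_starProjection_of_mem (hD.lamSeq_orthogonal ℓ hℓ ν x i),
      hD.lamSeq_expand ℓ hℓ ν x i, sum_inner]
    simp only [hxi, real_inner_smul_left]
  simp only [hsum]
  rcases lt_or_ge (i : ℕ) (Module.finrank ℝ (glaeserIter H (ℓ + 1) x)ᗮ) with hi | hi
  · rw [inner_starProjection_of_mem (hD.lam_mem_orthogonal ℓ hℓ x i hi)]
    exact (hD.lamSeq_tendsto ℓ hℓ x i hi).inner ((hF.tendsto x).comp (hD.y_tendsto ℓ hℓ x i))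
  · rw [Submodule.inner_right_of_mem_orthogonal (hD.lam_mem ℓ hℓ x i hi)
      (Submodule.starProjection_apply_mem _ _)]
    simp only [hD.lamSeq_eq ℓ hℓ _ x i hi, inner_zero_left, tendsto_const_nhds]

theorem xi_eq_inner (hD : D.IsAdmissible (kernelBundle f)) (hF : Continuous F)
    (hφ : ∀ x, ∑ i, F x i * f i x = φ x) {ℓ : ℕ} (hℓ : ℓ ≤ 2 * r + 1) (x : X) (i : Fin r) :
    xi f D φ ℓ x i =
      ⟪D.lam ℓ x i, (glaeserIter (kernelBundle f) ℓ x)ᗮ.starProjection (F x)⟫_ℝ := by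
  induction ℓ generalizing x i with
  | zero => exact xi_zero_eq_inner hD hφ x i
  | succ ℓ ih => exact (tendsto_sum_mul_xi hD hF hℓ (ih (Nat.le_of_succ_le hℓ)) x i).limUnder_eq

theorem succeeds_of_continuous (hD : D.IsAdmissible (kernelBundle f)) (hF : Continuous F)
    (hφ : ∀ x, ∑ i, F x i * f i x = φ x) : Succeeds f D φ := fun _ hℓ x i =>
  ⟨_, tendsto_sum_mul_xi hD hF hℓ (xi_eq_inner hD hF hφ hℓ.le) x i⟩

theorem sum_xi_smul_w (hD : D.IsAdmissible (kernelBundle f)) (hF : Continuous F)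
    (hφ : ∀ x, ∑ i, F x i * f i x = φ x) (x : X) :
    ∑ j, xi f D φ (2 * r + 1) x j • D.w x j =
      (glaeserIter (kernelBundle f) (2 * r + 1) x)ᗮ.starProjection (F x) := by
  simp only [xi_eq_inner hD hF hφ le_rfl, ← hD.w_dual x]

end Recursion

section Basis

theorem exists_sum_inner_smul_eq {ι 𝕜 E : Type*} [Fintype ι] [RCLike 𝕜] [NormedAddCommGroup E]
    [InnerProductSpace 𝕜 E] (b : Module.Basis ι 𝕜 E) :
    ∃ w : ι → E, ∀ v, v = ∑ i, ⟪b i, v⟫_𝕜 • w i := by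
  have : FiniteDimensional 𝕜 E := b.finiteDimensional_of_finite
  let T : E →ₗ[𝕜] ι → 𝕜 := LinearMap.pi fun i => (innerSL 𝕜 (b i)).toLinearMap
  have hT : Function.Injective T := fun _ _ huv =>
    InnerProductSpace.ext_inner_left_basis b (congrFun huv)
  let w := Module.Basis.ofEquivFun (T.linearEquivOfInjective hT (by
    rw [Module.finrank_eq_card_basis b, Module.finrank_fintype_fun_eq_card]))
  exact ⟨w, fun v => (w.sum_equivFun v).symm⟩

theorem exists_basis_mem_of_span_eq {𝕜 E : Type*} [Field 𝕜] [AddCommGroup E] [Module 𝕜 E]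
    {L : Set E} {W : Submodule 𝕜 E} [FiniteDimensional 𝕜 W] (hL : Submodule.span 𝕜 L = W) :
    ∃ b : Module.Basis (Fin (Module.finrank 𝕜 W)) 𝕜 W, ∀ i, (b i : E) ∈ L := by
  obtain ⟨B, hBL, hBspan, hB⟩ := exists_linearIndependent 𝕜 L
  let b := (Module.Basis.span hB).map
    (LinearEquiv.ofEq _ W (by rw [Subtype.range_coe, hBspan, hL]))
  have : Fintype B := FiniteDimensional.fintypeBasisIndex b
  refine ⟨b.reindex (Fintype.equivFinOfCardEq (Module.finrank_eq_card_basis b).symm), fun i => ?_⟩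
  simpa [b] using hBL (Subtype.coe_prop _)

theorem exists_basis_of_isCompl {𝕜 E : Type*} [Field 𝕜] [AddCommGroup E] [Module 𝕜 E]
    {W K : Submodule 𝕜 E} [FiniteDimensional 𝕜 E] (h : IsCompl W K) {L : Set E}
    (hL : Submodule.span 𝕜 L = W) {m : ℕ} (hm : Module.finrank 𝕜 E = m) :
    ∃ b : Module.Basis (Fin m) 𝕜 E,
      (∀ i : Fin m, (i : ℕ) < Module.finrank 𝕜 W → b i ∈ L) ∧
      ∀ i : Fin m, Module.finrank 𝕜 W ≤ (i : ℕ) → b i ∈ K := by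
  obtain ⟨b, hb⟩ := exists_basis_mem_of_span_eq hL
  let e := finSumFinEquiv.trans (finCongr ((Submodule.finrank_add_eq_of_isCompl h).trans hm))
  refine ⟨((b.prod (Module.finBasis 𝕜 K)).map (Submodule.prodEquivOfIsCompl W K h)).reindex e,
    fun i hi => ?_, fun i hi => ?_⟩ <;> obtain ⟨j | j, rfl⟩ := e.surjective i
  · simpa using hb j
  · exact absurd hi (by simp [e])
  · exact absurd hi (by simp [e])
  · simp

end Basis

section LimitNormals

variable {X : Type*} [TopologicalSpace X] {r : ℕ} {H : X → Submodule ℝ (Vec r)} {x : X}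

/-- The limits of vectors which are orthogonal to the fibers of `H` at points tending to `x`. -/
def limitNormals (H : X → Submodule ℝ (Vec r)) (x : X) : Set (Vec r) :=
  {μ | (x, μ) ∈ closure {p : X × Vec r | p.2 ∈ (H p.1)ᗮ}}

theorem inner_eq_zero_of_mem_limitNormals {μ v : Vec r} (hμ : μ ∈ limitNormals H x)
    (hv : v ∈ glaeser H x) : ⟪v, μ⟫_ℝ = 0 := by
  obtain ⟨U, hU, hUx⟩ := mem_closure_iff_ultrafilter.1 hμ
  obtain ⟨hx, hlim⟩ := Prod.tendsto_iff _ (x, μ) |>.1 (tendsto_id'.2 hUx)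
  refine tendsto_nhds_unique (((tendsto_starProjection_of_mem_glaeser hv).comp hx).inner hlim)
    (tendsto_const_nhds.congr' ?_)
  filter_upwards [hU] with p hp
  exact (Submodule.inner_right_of_mem_orthogonal ((H p.1).starProjection_apply_mem v) hp).symm

theorem mem_limitNormals_of_mapClusterPt {v μ : Vec r}
    (h : MapClusterPt μ (𝓝 x) fun y => (H y)ᗮ.starProjection v) : μ ∈ limitNormals H x := by
  obtain ⟨U, hU, hUμ⟩ := mapClusterPt_iff_ultrafilter.1 h
  exact mem_closure_of_tendsto (Tendsto.prodMk_nhds (tendsto_id.mono_left hU) hUμ)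
    (Eventually.of_forall fun y => (H y)ᗮ.starProjection_apply_mem v)

theorem mem_glaeser_of_forall_limitNormals {v : Vec r}
    (hv : ∀ μ ∈ limitNormals H x, ⟪μ, v⟫_ℝ = 0) : v ∈ glaeser H x := by
  refine mem_glaeser_iff.2 ⟨?_, ?_⟩
  · rw [← Submodule.orthogonal_orthogonal (H x), Submodule.mem_orthogonal]
    exact fun μ hμ => hv μ (subset_closure hμ)
  refine (isCompact_closedBall (0 : Vec r) ‖v‖).tendsto_nhds_of_unique_mapClusterPt
    (Eventually.of_forall fun y => mem_closedBall_zero_iff.2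
      (Submodule.norm_starProjection_apply_le _ v)) fun μ _ hμ => ?_
  have hself : ⟪μ, μ⟫_ℝ = ⟪μ, v⟫_ℝ :=
    (isClosed_eq (f := fun μ : Vec r => ⟪μ, μ⟫_ℝ) (g := fun μ => ⟪μ, v⟫_ℝ)
      (by fun_prop) (by fun_prop)).mem_of_mapClusterPt hμ (Eventually.of_forall fun y =>
        inner_starProjection_of_mem ((H y)ᗮ.starProjection_apply_mem v) v)
  rw [hv μ (mem_limitNormals_of_mapClusterPt hμ)] at hself
  exact inner_self_eq_zero.1 hself

theorem span_limitNormals (H : X → Submodule ℝ (Vec r)) (x : X) :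
    Submodule.span ℝ (limitNormals H x) = (glaeser H x)ᗮ := by
  refine le_antisymm (Submodule.span_le.2 fun μ hμ => ?_) ?_
  · exact (Submodule.mem_orthogonal _ _).2 fun v hv => inner_eq_zero_of_mem_limitNormals hμ hv
  · rw [← Submodule.orthogonal_orthogonal (Submodule.span ℝ _)]
    refine Submodule.orthogonal_le fun v hv => mem_glaeser_of_forall_limitNormals fun μ hμ => ?_
    exact (Submodule.mem_orthogonal _ _).1 hv μ (Submodule.subset_span hμ)

theorem exists_seq_of_imp_mem_limitNormals [FirstCountableTopology X] {p : Prop} {μ : Vec r}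
    (hμ : p → μ ∈ limitNormals H x) :
    ∃ z : ℕ → X × Vec r, (∀ ν, (z ν).2 ∈ (H (z ν).1)ᗮ) ∧
      Tendsto (fun ν => (z ν).1) atTop (𝓝 x) ∧
      (p → Tendsto (fun ν => (z ν).2) atTop (𝓝 μ)) ∧ (¬p → ∀ ν, z ν = (x, 0)) := by
  by_cases hp : p
  · obtain ⟨z, hz, hzx⟩ := mem_closure_iff_seq_limit.1 (hμ hp)
    exact ⟨z, hz, hzx.fst_nhds, fun _ => hzx.snd_nhds, fun h => absurd hp h⟩
  · exact ⟨fun _ => (x, 0), fun _ => Submodule.zero_mem _, tendsto_const_nhds,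
      fun h => absurd h hp, fun _ _ => rfl⟩

theorem exists_isAdmissible [FirstCountableTopology X] (H : X → Submodule ℝ (Vec r)) :
    ∃ D : LimitData X r, D.IsAdmissible H := by
  choose b hb_mem_limit hb_mem using fun (ℓ : ℕ) (x : X) =>
    exists_basis_of_isCompl (glaeserIter H (ℓ + 1) x).isCompl_orthogonal.symm
      ((span_limitNormals (glaeserIter H ℓ) x).trans (by rw [glaeserIter_succ]))
      (finrank_euclideanSpace_fin (𝕜 := ℝ) (n := r))
  choose z hz_mem hz_fst hz_snd hz_eq using fun (ℓ : ℕ) (x : X) (i : Fin r) =>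
    exists_seq_of_imp_mem_limitNormals (hb_mem_limit ℓ x i)
  let lam : ℕ → X → Module.Basis (Fin r) ℝ (Vec r)
    | 0, _ => (EuclideanSpace.basisFun (Fin r) ℝ).toBasis
    | ℓ + 1, x => b ℓ x
  choose w hw using fun x => exists_sum_inner_smul_eq (lam (2 * r + 1) x)
  exact ⟨{
    lam := fun ℓ x => lam ℓ x
    lamSeq := fun ℓ ν x i => (z (ℓ - 1) x i ν).2
    y := fun ℓ ν x i => (z (ℓ - 1) x i ν).1
    β := fun ℓ ν x i => (lam (ℓ - 1) (z (ℓ - 1) x i ν).1).repr (z (ℓ - 1) x i ν).2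
    w := w }, {
    lam_zero := fun x i => by simp [lam]
    lam_basis := fun ℓ _ x => (b ℓ x).linearIndependent
    lam_mem_orthogonal := fun ℓ _ x i hi => by
      rw [glaeserIter_succ, ← span_limitNormals]
      exact Submodule.subset_span (hb_mem_limit ℓ x i hi)
    lam_mem := fun ℓ _ x i hi => hb_mem ℓ x i hi
    y_tendsto := fun ℓ _ x i => hz_fst ℓ x i
    lamSeq_tendsto := fun ℓ _ x i hi => hz_snd ℓ x i hi
    lamSeq_orthogonal := fun ℓ _ ν x i => hz_mem ℓ x i ν
    y_eq := fun ℓ _ ν x i hi => congrArg Prod.fst (hz_eq ℓ x i hi.not_gt ν)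
    lamSeq_eq := fun ℓ _ ν x i hi => congrArg Prod.snd (hz_eq ℓ x i hi.not_gt ν)
    lamSeq_expand := fun ℓ _ ν x i => ((lam ℓ _).sum_repr _).symm
    w_dual := hw }⟩

end LimitNormals

section Main

theorem exists_hasDepth_section {n r : ℕ} {X : Set (EuclideanSpace ℝ (Fin n))}
    {H : X → Submodule ℝ (Vec r)} (hH : glaeser H = H) :
    ∃ T : (X → Vec r) → X → Vec r,
      (∀ x, HasDepth ℝ (∑ i ∈ Finset.range (r + 1), (2 * 2 ^ n) ^ i) fun g => T g x) ∧
      ∀ F : X → Vec r, Continuous F →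
        Continuous (T fun x => (H x)ᗮ.starProjection (F x)) ∧
        (∀ x, T (fun y => (H y)ᗮ.starProjection (F y)) x - F x ∈ H x) ∧
        ∀ M : ℝ, (∀ x, ‖F x‖ ≤ M) →
          ∀ x, ‖T (fun y => (H y)ᗮ.starProjection (F y)) x‖ ≤ (r + 1) * M := by
  choose P hP using fun k =>
    exists_isExtensionOperator (V := Vec r) (isClosed_setOf_finrank_lt hH k)
  have hrank : {x | Module.finrank ℝ (H x) < r + 1} = Set.univ := Set.eq_univ_of_forall fun x =>
    Nat.lt_succ_of_le ((Submodule.finrank_le _).trans_eq finrank_euclideanSpace_fin)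
  refine ⟨selection H P (r + 1), hasDepth_selection hP (r + 1), fun F hF =>
    ⟨?_, selection_sub_mem r F, fun M hM x => ?_⟩⟩
  · rw [← continuousOn_univ, ← hrank]
    exact continuousOn_selection hP hH hF (r + 1)
  · exact_mod_cast norm_selection_le hP
      (fun y => (Submodule.norm_starProjection_apply_le _ _).trans (hM y)) (r + 1) x

theorem isCompact_closedCube {n : ℕ} (a : EuclideanSpace ℝ (Fin n)) (δ : ℝ) :
    IsCompact (closedCube a δ) := by
  have h : closedCube a δ = EuclideanSpace.equiv (Fin n) ℝ ⁻¹'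
      Set.Icc (fun k => a k) fun k => a k + δ := by
    ext x
    exact forall_and
  rw [h]
  exact (EuclideanSpace.equiv (Fin n) ℝ).toHomeomorph.isCompact_preimage.2 isCompact_Icc

theorem bddAbove_range_abs {X ι : Type*} [TopologicalSpace X] [CompactSpace X] [Finite ι]
    {g : ι → X → ℝ} (hg : ∀ i, Continuous (g i)) :
    BddAbove (Set.range fun p : X × ι => |g p.2 p.1|) := by
  let _ : TopologicalSpace ι := ⊥
  have : DiscreteTopology ι := ⟨rfl⟩
  exact (isCompact_range (continuous_abs.comp
    (continuous_prod_of_discrete_right.2 hg))).bddAbove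

theorem iSup_abs_le_of_norm_bound {X : Type*} {r : ℕ} {φs : Fin r → X → ℝ}
    (hbdd : BddAbove (Set.range fun p : X × Fin r => |φs p.2 p.1|)) {G : X → Vec r}
    {c : ℝ} (hc : 0 ≤ c)
    (hG : ∀ M, (∀ x, ‖(WithLp.toLp 2 fun i => φs i x : Vec r)‖ ≤ M) → ∀ x, ‖G x‖ ≤ c * M) :
    ⨆ p : X × Fin r, |G p.1 p.2| ≤ c * √r * ⨆ p : X × Fin r, |φs p.2 p.1| := by
  have hM : 0 ≤ ⨆ p : X × Fin r, |φs p.2 p.1| := Real.iSup_nonneg fun _ => abs_nonneg _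
  refine Real.iSup_le (fun p => (PiLp.norm_apply_le (G p.1) p.2).trans ?_) (by positivity)
  rw [mul_assoc]
  exact hG _ (fun x => norm_le_sqrt_mul_of_forall_abs_le hM fun i => le_ciSup hbdd (x, i)) p.1

end Main

end GlaeserProcedure

open GlaeserProcedure in
theorem theorem3_general (n r : ℕ) :
    ∃ (d : ℕ) (C : ℝ), ∀ (X : Set (EuclideanSpace ℝ (Fin n))) (f : Fin r → X → ℝ),
      (∃ D : LimitData X r, D.IsAdmissible (kernelBundle f)) ∧
      ∃ (S : X → Finset X) (A : X → X → Vec r →ₗ[ℝ] Vec r),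
        (∀ x, (S x).card ≤ d) ∧
        ∀ D : LimitData X r, D.IsAdmissible (kernelBundle f) →
          ∀ (φ : X → ℝ) (φs : Fin r → X → ℝ),
            (∀ i, Continuous (φs i)) → (∀ x, ∑ i, φs i x * f i x = φ x) →
              Succeeds f D φ ∧
              (∀ i, Continuous (output f D S A φ i)) ∧
              (∀ x, ∑ i, output f D S A φ i x * f i x = φ x) ∧
              (BddAbove (Set.range fun p : X × Fin r => |φs p.2 p.1|) →
                (⨆ p : X × Fin r, |output f D S A φ p.2 p.1|) ≤
                  C * ⨆ p : X × Fin r, |φs p.2 p.1|) := by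
  refine ⟨∑ i ∈ Finset.range (r + 1), (2 * 2 ^ n) ^ i, (r + 1) * √r, fun X f =>
    ⟨exists_isAdmissible _, ?_⟩⟩
  obtain ⟨T, hdepth, hT⟩ :=
    exists_hasDepth_section (glaeser_glaeserIter_eq (kernelBundle f) (Nat.le_succ (2 * r)))
  choose A hcard hA using hdepth
  refine ⟨fun x => (A x).support, fun x => A x, hcard, fun D hD φ φs hφs hφ => ?_⟩
  let F (x : X) : Vec r := WithLp.toLp 2 fun i => φs i x
  have hF : Continuous F := (PiLp.continuous_toLp 2 _).comp (continuous_pi hφs)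
  obtain ⟨hcont, hmem, hbound⟩ := hT F hF
  have hout : output f D (fun x => (A x).support) (fun x => A x) φ = fun i x =>
      T (fun y => (glaeserIter (kernelBundle f) (2 * r + 1) y)ᗮ.starProjection (F y)) x i := by
    funext i x
    simp only [output_eq, sum_xi_smul_w hD hF hφ, hA, Finsupp.sum]
  rw [hout]
  refine ⟨succeeds_of_continuous hD hF hφ, fun i => by fun_prop, fun x => ?_, fun hbdd =>
    iSup_abs_le_of_norm_bound hbdd (by positivity) hbound⟩
  rw [← hφ x]
  exact sum_mul_eq_of_sub_mem_kernelBundle (glaeserIter_antitone _ x (Nat.zero_le _) (hmem x))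

open GlaeserProcedure in
theorem theorem3 (n r : ℕ) (hn : 0 < n) (hr : 0 < r) :
    ∃ (d : ℕ) (C : ℝ), ∀ (a : EuclideanSpace ℝ (Fin n)) (δ : ℝ), 0 < δ →
      ∀ f : Fin r → closedCube a δ → ℝ,
        (∃ D : LimitData (closedCube a δ) r, D.IsAdmissible (kernelBundle f)) ∧
        ∃ (S : closedCube a δ → Finset (closedCube a δ))
          (A : closedCube a δ → closedCube a δ → Vec r →ₗ[ℝ] Vec r),
          (∀ x, (S x).card ≤ d) ∧
          ∀ D : LimitData (closedCube a δ) r, D.IsAdmissible (kernelBundle f) →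
            ∀ (φ : closedCube a δ → ℝ) (φs : Fin r → closedCube a δ → ℝ),
              (∀ i, Continuous (φs i)) → (∀ x, ∑ i, φs i x * f i x = φ x) →
                Succeeds f D φ ∧
                (∀ i, Continuous (output f D S A φ i)) ∧
                (∀ x, ∑ i, output f D S A φ i x * f i x = φ x) ∧
                (⨆ p : closedCube a δ × Fin r, |output f D S A φ p.2 p.1|) ≤
                  C * ⨆ p : closedCube a δ × Fin r, |φs p.2 p.1| := by
  obtain ⟨d, C, h⟩ := theorem3_general n r
  refine ⟨d, C, fun a δ _ f => (h (closedCube a δ) f).imp_right ?_⟩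
  have := isCompact_iff_compactSpace.1 (isCompact_closedCube a δ)
  exact fun ⟨S, A, hS, hA⟩ => ⟨S, A, hS, fun D hD φ φs hφs hφ =>
    (hA D hD φ φs hφs hφ).imp_right (.imp_right (.imp_right (· (bddAbove_range_abs hφs))))⟩
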